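/- Let $k$ be a field, $n\ge 0$, and $R=k[x_1,\dots,x_n]$ with the standard grading $\deg x_i=1$. Let $r\ge 1$ be an integer. For a homogeneous ideal $J\subseteq R$ let $\beta_{i,j}(J)$ denote its graded Betti numbers, i.e. the number of basis elements of degree $j$ in homological degree $i$ of the minimal graded free resolution $\cdots\to F_1\to F_0\to J\to 0$ of $J$. The ideal $J$ is called linear in the first $r$ steps if there is an integer $d$ such that $\beta_{i,i+t}(J)=0$ for all $0\le i<r$ and all integers $t\ne d$. Let $I\subseteq R$ be a squarefree monomial ideal, i.e. an ideal generated by squarefree monomials. For $j\ge 0$ let $I_{<j>}$ be the ideal generated by all homogeneous polynomials of degree $j$ belonging to $I$, and let $I_{[j]}$ be the ideal generated by all squarefree monomials of degree $j$ belonging to $I$. Then the following are equivalent: (a) $I$ is componentwise linear in the first $r$ steps, i.e. $I_{<j>}$ is linear in the first $r$ steps for all $j\ge 0$; (b) $I$ is squarefree componentwise linear in the first $r$ steps, i.e. $I_{[j]}$ is linear in the first $r$ steps for all $j\ge 0$. -/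

import Mathlib

open MvPolynomial

/-- A minimal graded free resolution
`⋯ ⟶ F₂ ⟶ F₁ ⟶ F₀ ⟶ I ⟶ 0` of an ideal `I` of the standard graded polynomial ring
`R = k[x₁, …, xₙ]`. Here `F i` is the graded free module of finite rank `rank i` whose `a`-th basis
element sits in degree `deg i a`, i.e. `F i = ⨁ₐ R(-deg i a)`. The augmentation `F₀ ⟶ I` sends the
`a`-th basis element to `gen a`, and the differential `F (i+1) ⟶ F i` is multiplication by the
matrix `d i`. -/
structure MinimalGradedFreeResolution {k : Type*} [Field k] {n : ℕ}
    (I : Ideal (MvPolynomial (Fin n) k)) where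
  /-- the rank of the free module in homological degree `i` -/
  rank : ℕ → ℕ
  /-- the degrees of the basis elements -/
  deg : (i : ℕ) → Fin (rank i) → ℤ
  /-- the images in `I` of the basis elements in homological degree `0` -/
  gen : Fin (rank 0) → MvPolynomial (Fin n) k
  /-- the matrices of the differentials -/
  d : (i : ℕ) → Matrix (Fin (rank i)) (Fin (rank (i + 1))) (MvPolynomial (Fin n) k)
  /-- the augmentation is homogeneous of degree `0` -/
  gen_homogeneous : ∀ a, ∀ m ∈ (gen a).support, (m.degree : ℤ) = deg 0 a
  /-- the differentials are homogeneous of degree `0` -/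
  d_homogeneous : ∀ i a b, ∀ m ∈ (d i a b).support, (m.degree : ℤ) + deg i a = deg (i + 1) b
  /-- the augmentation maps onto `I` -/
  span_gen : Ideal.span (Set.range gen) = I
  /-- exactness in homological degree `0` -/
  exact_zero : LinearMap.ker (Fintype.linearCombination (MvPolynomial (Fin n) k) gen) =
    LinearMap.range (d 0).mulVecLin
  /-- exactness in positive homological degrees -/
  exact_succ : ∀ i, LinearMap.ker (d i).mulVecLin = LinearMap.range (d (i + 1)).mulVecLin
  /-- minimality: all entries of the differentials lie in the ideal `(x₁, …, xₙ)` -/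
  minimal : ∀ i a b, d i a b ∈ Ideal.span (Set.range (X : Fin n → MvPolynomial (Fin n) k))

/-- The graded Betti number `β_{i,j}(I)`, read off from a minimal graded free resolution `F` of `I`:
the number of basis elements of degree `j` in homological degree `i`. (It does not depend on `F`,
since a minimal graded free resolution is unique up to isomorphism.) -/
def MinimalGradedFreeResolution.betti {k : Type*} [Field k] {n : ℕ}
    {I : Ideal (MvPolynomial (Fin n) k)} (F : MinimalGradedFreeResolution I) (i : ℕ) (j : ℤ) : ℕ :=
  Fintype.card {a : Fin (F.rank i) // F.deg i a = j}

/-- `I` is linear in the first `r` steps: for some integer `d`, `β_{i,i+t}(I) = 0` for all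
`0 ≤ i < r` and all `t ≠ d`, the Betti numbers being those of the (essentially unique) minimal
graded free resolution of `I`. -/
def IsLinearInFirstSteps {k : Type*} [Field k] {n : ℕ} (r : ℕ)
    (I : Ideal (MvPolynomial (Fin n) k)) : Prop :=
  ∃ F : MinimalGradedFreeResolution I, ∃ d : ℤ, ∀ i : ℕ, i < r → ∀ t : ℤ, t ≠ d →
    F.betti i ((i : ℤ) + t) = 0

/-- `I_{<j>}`: the ideal generated by all homogeneous polynomials of degree `j` belonging to `I`. -/
noncomputable def homogeneousComponentIdeal {k : Type*} [Field k] {n : ℕ}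
    (I : Ideal (MvPolynomial (Fin n) k)) (j : ℕ) : Ideal (MvPolynomial (Fin n) k) :=
  Ideal.span {f | f ∈ I ∧ f.IsHomogeneous j}

/-- The squarefree monomial `∏_{i ∈ s} xᵢ`; its degree is the cardinality of `s`. -/
noncomputable def squarefreeMonomial (k : Type*) [Field k] {n : ℕ} (s : Finset (Fin n)) :
    MvPolynomial (Fin n) k :=
  ∏ i ∈ s, X i

/-- `I_{[j]}`: the ideal generated by the squarefree monomials of degree `j` belonging to `I`. -/
noncomputable def squarefreeComponentIdeal {k : Type*} [Field k] {n : ℕ}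
    (I : Ideal (MvPolynomial (Fin n) k)) (j : ℕ) : Ideal (MvPolynomial (Fin n) k) :=
  Ideal.span {f | f ∈ I ∧ ∃ s : Finset (Fin n), s.card = j ∧ f = squarefreeMonomial k s}

/-- `I` is a squarefree monomial ideal: it is generated by squarefree monomials. -/
def IsSquarefreeMonomialIdeal {k : Type*} [Field k] {n : ℕ}
    (I : Ideal (MvPolynomial (Fin n) k)) : Prop :=
  ∃ S : Set (Finset (Fin n)), I = Ideal.span (squarefreeMonomial k '' S)

/-- `I` is componentwise linear in the first `r` steps. -/
def IsComponentwiseLinearInFirstSteps {k : Type*} [Field k] {n : ℕ} (r : ℕ)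
    (I : Ideal (MvPolynomial (Fin n) k)) : Prop :=
  ∀ j : ℕ, IsLinearInFirstSteps r (homogeneousComponentIdeal I j)

/-- `I` is squarefree componentwise linear in the first `r` steps. -/
def IsSquarefreeComponentwiseLinearInFirstSteps {k : Type*} [Field k] {n : ℕ} (r : ℕ)
    (I : Ideal (MvPolynomial (Fin n) k)) : Prop :=
  ∀ j : ℕ, IsLinearInFirstSteps r (squarefreeComponentIdeal I j)

/-! The equivalence holds for each degree `j` separately: `I_{<j>}` is linear in the first `r` steps
if and only if `I_{[j]}` is.

The Betti numbers of a graded ideal `J` are the dimensions of the graded pieces of the homology of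
the Koszul complex `K(x₁, …, xₙ) ⊗ J`. Only their vanishing matters
(`MinimalGradedFreeResolution.betti_eq_zero_iff`), and it is obtained without `Tor`: the Koszul
complex of a graded free module is acyclic, so Koszul homology shifts along the short exact sequences
of a minimal resolution (`IsMinimalCover.koszulVanishes_succ_iff`), down to homological degree `0`,
where it counts generators (`IsMinimalCover.koszulVanishes_zero_iff`).

If `J` is spanned by monomials, its Koszul complex splits into multidegrees. In multidegree `a` it is
the augmented chain complex of the simplicial complex of all `s` such that `x^a / x^s ∈ J`
(`koszulVanishes_monomialPiece_iff`).

* If `a` is squarefree, the complexes of `I_{<j>}` and `I_{[j]}` coincide, since a squarefree monomial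
  that is a multiple of a monomial of degree `j` in `I` is a multiple of a squarefree one.
* If `a v ≥ 2` for some `v`, removing `x_v` from `x^a / x^s` does not change which squarefree
  monomials divide it. So the complex of `I_{[j]}` is a cone with apex `v`, hence acyclic. That of
  `I_{<j>}` is the skeleton of faces of cardinality at most `|a| - j` of such a cone, so that its
  homology sits in homological degree `i = |a| - j` only, which is where linearity allows it.

This is `simplicialVanishes_component_iff`. Minimal graded free resolutions exist by
`exists_minimalGradedFreeResolution`, and a nonzero ideal generated in degree `j` can be linear only
with `d = j` (`isLinearInFirstSteps_iff`). -/

/-! ### Koszul chains and their differential -/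

/-- The Koszul sign of `v` relative to `s`: the parity of the number of elements of `s` below `v`. -/
def koszulSign {n : ℕ} (v : Fin n) (s : Finset (Fin n)) : ℤ :=
  (-1) ^ (s.filter (· < v)).card

theorem koszulSign_mul_self {n : ℕ} (v : Fin n) (s : Finset (Fin n)) :
    koszulSign v s * koszulSign v s = 1 := by
  unfold koszulSign
  rw [← mul_pow]
  simp

theorem koszulSign_swap {n : ℕ} {v w : Fin n} {s : Finset (Fin n)} (hv : v ∉ s) (hw : w ∉ s)
    (hvw : v ≠ w) :
    koszulSign w s * koszulSign v (insert w s) = -(koszulSign v s * koszulSign w (insert v s)) := by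
  wlog h : v < w generalizing v w
  · have := this hw hv hvw.symm (lt_of_le_of_ne (not_lt.1 h) hvw.symm)
    rw [this, neg_neg]
  · unfold koszulSign
    rw [Finset.filter_insert, if_neg (not_lt.2 h.le), Finset.filter_insert, if_pos h,
      Finset.card_insert_of_notMem (by simp [hv]), pow_succ]
    ring

/-- The Koszul differential on an `A`-module `M` for a sequence `x` of elements of `A`. A chain is a
function on all subsets of `Fin n`; those supported on subsets of cardinality `i` form the chains of
homological degree `i`. -/
def koszulD {n : ℕ} {A : Type*} [CommRing A] (x : Fin n → A) {M : Type*} [AddCommGroup M]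
    [Module A M] (c : Finset (Fin n) → M) : Finset (Fin n) → M :=
  fun s => ∑ v ∈ sᶜ, koszulSign v s • x v • c (insert v s)

section Koszul

variable {n : ℕ} {A : Type*} [CommRing A] (x : Fin n → A) {M N : Type*} [AddCommGroup M]
  [Module A M] [AddCommGroup N] [Module A N]

theorem koszulD_sub (b c : Finset (Fin n) → M) :
    koszulD x (b - c) = koszulD x b - koszulD x c := by
  funext s
  simp [koszulD, smul_sub, Finset.sum_sub_distrib]

theorem koszulD_zero : koszulD x (0 : Finset (Fin n) → M) = 0 := by
  funext s
  simp [koszulD]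

theorem koszulD_comp (φ : M →ₗ[A] N) (c : Finset (Fin n) → M) :
    koszulD x (fun s => φ (c s)) = fun s => φ (koszulD x c s) := by
  funext s
  simp [koszulD, map_sum, map_zsmul]

theorem koszulD_koszulD (c : Finset (Fin n) → M) : koszulD x (koszulD x c) = 0 := by
  funext s
  simp only [koszulD, Finset.smul_sum, Pi.zero_apply]
  rw [Finset.sum_sigma']
  refine Finset.sum_involution (fun p _ => ⟨p.2, p.1⟩) ?_ ?_ ?_ ?_
  · rintro ⟨v, w⟩ h
    simp only [Finset.mem_sigma, Finset.mem_compl, Finset.mem_insert, not_or] at h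
    obtain ⟨hv, hwv, hw⟩ := h
    have key := koszulSign_swap hv hw (Ne.symm hwv)
    simp only [smul_comm (x _) (koszulSign _ _), smul_smul]
    rw [key, Finset.insert_comm w v s, mul_comm (x w) (x v), neg_smul, add_neg_cancel]
  · rintro ⟨v, w⟩ h _ h2
    simp only [Finset.mem_sigma, Finset.mem_compl, Finset.mem_insert, not_or] at h
    simp only [Sigma.mk.injEq] at h2
    exact h.2.1 h2.1
  · rintro ⟨v, w⟩ h
    simp only [Finset.mem_sigma, Finset.mem_compl, Finset.mem_insert, not_or] at h ⊢
    exact ⟨h.2.2, fun e => h.2.1 e.symm, h.1⟩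
  · rintro ⟨v, w⟩ h
    rfl

theorem koszulD_apply_eq_zero {c : Finset (Fin n) → M} {i : ℕ} (hc : ∀ s, s.card ≠ i + 1 → c s = 0)
    {s : Finset (Fin n)} (hs : s.card ≠ i) : koszulD x c s = 0 := by
  refine Finset.sum_eq_zero fun v hv => ?_
  rw [hc, smul_zero, smul_zero]
  rw [Finset.card_insert_of_notMem (Finset.mem_compl.1 hv)]
  omega

end Koszul

/-- The contracting homotopy of a simplicial cone with apex `v`. -/
def coneHomotopy {n : ℕ} {k : Type*} [CommRing k] (v : Fin n) (c : Finset (Fin n) → k) :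
    Finset (Fin n) → k :=
  fun s => if v ∈ s then koszulSign v (s.erase v) • c (s.erase v) else 0

theorem koszulD_coneHomotopy {n : ℕ} {k : Type*} [CommRing k] (v : Fin n)
    {c : Finset (Fin n) → k} (hc : koszulD (1 : Fin n → k) c = 0) :
    koszulD (1 : Fin n → k) (coneHomotopy v c) = c := by
  funext s
  by_cases hv : v ∈ s
  · obtain ⟨t, ht, rfl⟩ : ∃ t, v ∉ t ∧ s = insert v t :=
      ⟨s.erase v, Finset.notMem_erase v s, (Finset.insert_erase hv).symm⟩
    have h0 := congrFun hc t
    simp only [koszulD, Pi.one_apply, one_smul, Pi.zero_apply] at h0 ⊢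
    have hcompl : tᶜ = insert v (insert v t)ᶜ := by
      ext u; simp only [Finset.mem_compl, Finset.mem_insert]
      by_cases hu : u = v
      · subst hu; simp [ht]
      · simp [hu]
    rw [hcompl, Finset.sum_insert (by simp)] at h0
    have h1 : ∑ w ∈ (insert v t)ᶜ,
        koszulSign w (insert v t) • coneHomotopy v c (insert w (insert v t)) =
          -(koszulSign v t • ∑ w ∈ (insert v t)ᶜ, koszulSign w t • c (insert w t)) := by
      rw [Finset.smul_sum, ← Finset.sum_neg_distrib]
      refine Finset.sum_congr rfl fun w hw => ?_
      simp only [Finset.mem_compl, Finset.mem_insert, not_or] at hw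
      have he : (insert w (insert v t)).erase v = insert w t := by
        rw [Finset.insert_comm, Finset.erase_insert]
        simp [ht, Ne.symm hw.1]
      have key := koszulSign_swap ht hw.2 (Ne.symm hw.1)
      rw [coneHomotopy, if_pos (by simp), he, smul_smul, smul_smul, ← neg_smul]
      congr 1
      have hv1 := koszulSign_mul_self v t
      have hv2 := koszulSign_mul_self v (insert w t)
      linear_combination (koszulSign v t * koszulSign v (insert w t)) * key
        - koszulSign w (insert v t) * koszulSign v (insert w t) * hv1
        - koszulSign v t * koszulSign w t * hv2
    rw [h1, eq_neg_of_add_eq_zero_right h0, smul_neg, neg_neg, smul_smul, koszulSign_mul_self,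
      one_smul]
  · simp only [koszulD, Pi.one_apply, one_smul]
    rw [Finset.sum_eq_single v]
    · rw [coneHomotopy, if_pos (by simp), Finset.erase_insert hv, smul_smul, koszulSign_mul_self,
        one_smul]
    · intro w _ hw
      rw [coneHomotopy, if_neg (by simp [hv, Ne.symm hw]), smul_zero]
    · intro h
      exact absurd (Finset.mem_compl.2 hv) h

/-! ### Multigraded slices of Koszul chains -/

/-- The exponent vector of the squarefree monomial `∏_{v ∈ s} x_v`. -/
noncomputable def indExp {n : ℕ} (s : Finset (Fin n)) : Fin n →₀ ℕ :=
  ∑ v ∈ s, Finsupp.single v 1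

theorem indExp_apply {n : ℕ} (s : Finset (Fin n)) (v : Fin n) :
    indExp s v = if v ∈ s then 1 else 0 := by
  simp [indExp, Finsupp.finsetSum_apply, Finsupp.single_apply]

theorem indExp_insert {n : ℕ} {s : Finset (Fin n)} {v : Fin n} (hv : v ∉ s) :
    indExp (insert v s) = Finsupp.single v 1 + indExp s :=
  Finset.sum_insert hv

theorem degree_indExp {n : ℕ} (s : Finset (Fin n)) : (indExp s).degree = s.card := by
  simp [indExp, map_sum]

theorem squarefreeMonomial_eq {k : Type*} [Field k] {n : ℕ} (s : Finset (Fin n)) :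
    squarefreeMonomial k s = monomial (indExp s) 1 := by
  rw [squarefreeMonomial, indExp, monomial_sum_one]
  rfl

section Slices

variable {k : Type*} [Field k] {n : ℕ}

open Classical in
/-- The part of multidegree `a` of a Koszul chain with polynomial coefficients, as a simplicial
chain: `s` has coefficient that of `x^a / x^s` in `c s`. -/
noncomputable def slice (a : Fin n →₀ ℕ) (c : Finset (Fin n) → MvPolynomial (Fin n) k) :
    Finset (Fin n) → k :=
  fun s => if indExp s ≤ a then coeff (a - indExp s) (c s) else 0

theorem slice_of_le {a : Fin n →₀ ℕ} {c : Finset (Fin n) → MvPolynomial (Fin n) k}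
    {s : Finset (Fin n)} (h : indExp s ≤ a) : slice a c s = coeff (a - indExp s) (c s) :=
  if_pos h

theorem slice_ne_zero {a : Fin n →₀ ℕ} {c : Finset (Fin n) → MvPolynomial (Fin n) k}
    {s : Finset (Fin n)} (h : slice a c s ≠ 0) :
    indExp s ≤ a ∧ a - indExp s ∈ (c s).support := by
  by_cases hs : indExp s ≤ a
  · rw [slice_of_le hs] at h
    exact ⟨hs, mem_support_iff.2 h⟩
  · exact absurd (if_neg hs) h

theorem slice_zero (a : Fin n →₀ ℕ) :
    slice a (0 : Finset (Fin n) → MvPolynomial (Fin n) k) = 0 := by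
  funext s; simp [slice]

/-- Taking slices turns the Koszul differential for `x₁, …, xₙ` into the simplicial one, which is the
Koszul differential for `1, …, 1`. -/
theorem slice_koszulD (a : Fin n →₀ ℕ) (c : Finset (Fin n) → MvPolynomial (Fin n) k) :
    slice a (koszulD (X : Fin n → MvPolynomial (Fin n) k) c) =
      koszulD (1 : Fin n → k) (slice a c) := by
  funext s
  simp only [koszulD, Pi.one_apply, one_smul]
  by_cases hs : indExp s ≤ a
  · rw [slice_of_le hs, koszulD, coeff_sum]
    refine Finset.sum_congr rfl fun v hv => ?_
    have hv' : v ∉ s := Finset.mem_compl.1 hv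
    have hcoeff : ∀ (z : ℤ) (m : Fin n →₀ ℕ) (p : MvPolynomial (Fin n) k),
        coeff m (z • p) = z • coeff m p := fun z m p => map_zsmul (lcoeff k m) z p
    rw [hcoeff, smul_eq_mul, coeff_X_mul']
    congr 1
    have hi : indExp (insert v s) ≤ a ↔ v ∈ (a - indExp s).support := by
      rw [indExp_insert hv', Finsupp.mem_support_iff, ← le_tsub_iff_right hs, Finsupp.single_le_iff]
      omega
    by_cases h : v ∈ (a - indExp s).support
    · rw [if_pos h, slice_of_le (hi.2 h), indExp_insert hv', tsub_tsub, add_comm]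
    · rw [if_neg h, slice, if_neg (fun h' => h (hi.1 h'))]
  · rw [slice, if_neg hs]
    symm
    refine Finset.sum_eq_zero fun v hv => ?_
    rw [slice, if_neg, smul_zero]
    rw [indExp_insert (Finset.mem_compl.1 hv)]
    exact fun h => hs (le_trans le_add_self h)

theorem slice_ext {b c : Finset (Fin n) → MvPolynomial (Fin n) k}
    (h : ∀ a, slice a b = slice a c) : b = c := by
  funext s
  ext m
  have := congrFun (h (m + indExp s)) s
  rwa [slice_of_le le_add_self, slice_of_le le_add_self, add_tsub_cancel_right] at this

/-- The chain with polynomial coefficients, concentrated in multidegree `a`, with slice `g`. -/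
noncomputable def unslice (a : Fin n →₀ ℕ) (g : Finset (Fin n) → k) :
    Finset (Fin n) → MvPolynomial (Fin n) k :=
  fun s => monomial (a - indExp s) (g s)

theorem slice_unslice_self {a : Fin n →₀ ℕ} {g : Finset (Fin n) → k}
    (hg : ∀ s, g s ≠ 0 → indExp s ≤ a) : slice a (unslice a g) = g := by
  funext s
  by_cases h : indExp s ≤ a
  · rw [slice_of_le h, unslice, coeff_monomial, if_pos rfl]
  · rw [slice, if_neg h]
    by_contra h'
    exact h (hg s (Ne.symm h'))

theorem slice_unslice_of_ne {a b : Fin n →₀ ℕ} (hab : a ≠ b) {g : Finset (Fin n) → k}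
    (hg : ∀ s, g s ≠ 0 → indExp s ≤ a) : slice b (unslice a g) = 0 := by
  funext s
  by_contra h
  obtain ⟨h1, h2⟩ := slice_ne_zero h
  rw [mem_support_iff, unslice, coeff_monomial] at h2
  have h3 : a - indExp s = b - indExp s := by
    by_contra h4; rw [if_neg h4] at h2; exact h2 rfl
  have h5 : g s ≠ 0 := by rwa [if_pos h3] at h2
  exact hab (by rw [← tsub_add_cancel_of_le (hg s h5), h3, tsub_add_cancel_of_le h1])

theorem slice_finsetSum {ι : Type*} (A : Finset ι) (b : Fin n →₀ ℕ)
    (f : ι → Finset (Fin n) → MvPolynomial (Fin n) k) :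
    slice b (∑ i ∈ A, f i) = ∑ i ∈ A, slice b (f i) := by
  funext s
  rw [Finset.sum_apply]
  by_cases h : indExp s ≤ b
  · simp [slice_of_le h, Finset.sum_apply, coeff_sum]
  · simp [slice, h]

/-- Boundaries can be recognized one multidegree at a time. -/
theorem exists_koszulD_eq_of_slices {c : Finset (Fin n) → MvPolynomial (Fin n) k}
    {P : Finset (Fin n) → (Fin n →₀ ℕ) → Prop}
    (h : ∀ a, slice a c ≠ 0 → ∃ g : Finset (Fin n) → k,
      (∀ s, g s ≠ 0 → indExp s ≤ a ∧ P s (a - indExp s)) ∧ koszulD (1 : Fin n → k) g = slice a c) :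
    ∃ b : Finset (Fin n) → MvPolynomial (Fin n) k,
      (∀ s, ∀ m ∈ (b s).support, P s m) ∧ koszulD (X : Fin n → MvPolynomial (Fin n) k) b = c := by
  classical
  choose! g hg hgc using h
  let A : Finset (Fin n →₀ ℕ) :=
    (Finset.univ.biUnion fun s => (c s).support.image (· + indExp s)).filter fun a => slice a c ≠ 0
  have hA : ∀ a, slice a c ≠ 0 → a ∈ A := by
    intro a ha
    refine Finset.mem_filter.2 ⟨?_, ha⟩
    obtain ⟨s, hs⟩ := Function.ne_iff.1 ha
    obtain ⟨h1, h2⟩ := slice_ne_zero hs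
    exact Finset.mem_biUnion.2 ⟨s, Finset.mem_univ _, Finset.mem_image.2
      ⟨_, h2, tsub_add_cancel_of_le h1⟩⟩
  have hA' : ∀ a ∈ A, slice a c ≠ 0 := fun a ha => (Finset.mem_filter.1 ha).2
  refine ⟨∑ a ∈ A, unslice a (g a), ?_, ?_⟩
  · intro s m hm
    rw [Finset.sum_apply] at hm
    obtain ⟨a, ha, hm⟩ := Finset.mem_biUnion.1 (support_sum hm)
    rw [mem_support_iff, unslice, coeff_monomial] at hm
    by_cases h1 : a - indExp s = m
    · rw [if_pos h1] at hm
      rw [← h1]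
      exact (hg a (hA' a ha) s hm).2
    · rw [if_neg h1] at hm
      exact absurd rfl hm
  · refine slice_ext fun a => ?_
    rw [slice_koszulD, slice_finsetSum]
    by_cases ha : a ∈ A
    · rw [Finset.sum_eq_single a, slice_unslice_self fun s hs => (hg a (hA' a ha) s hs).1,
        hgc a (hA' a ha)]
      · exact fun b hb hba => slice_unslice_of_ne hba fun s hs => (hg b (hA' b hb) s hs).1
      · exact fun h => absurd ha h
    · rw [Finset.sum_eq_zero, koszulD_zero]
      · by_contra h
        exact ha (hA a (Ne.symm h))
      · intro b hb
        exact slice_unslice_of_ne (fun h : b = a => ha (h ▸ hb))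
          fun s hs => (hg b (hA' b hb) s hs).1

/-! ### Vanishing of Koszul homology -/

/-- Vanishing of the Koszul homology, in homological degree `i` and internal degree `t`, of the
graded module with graded pieces `ℳ`. The internal degree is that of the coefficients of a chain,
so that the total degree is `i + t`. -/
def KoszulVanishes (k : Type*) [Field k] (n : ℕ) {G : Type*} [AddCommGroup G]
    [Module (MvPolynomial (Fin n) k) G] (ℳ : ℤ → AddSubgroup G) (i : ℕ) (t : ℤ) : Prop :=
  ∀ c : Finset (Fin n) → G, (∀ s, c s ∈ ℳ t) → (∀ s, s.card ≠ i → c s = 0) →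
    koszulD (X : Fin n → MvPolynomial (Fin n) k) c = 0 →
    ∃ b : Finset (Fin n) → G, (∀ s, b s ∈ ℳ (t - 1)) ∧ (∀ s, s.card ≠ i + 1 → b s = 0) ∧
      koszulD (X : Fin n → MvPolynomial (Fin n) k) b = c

/-- The polynomials that are homogeneous of degree `t` and all of whose monomials lie in `U`. -/
def monomialPiece (k : Type*) [Field k] {n : ℕ} (U : Set (Fin n →₀ ℕ)) (t : ℤ) :
    AddSubgroup (MvPolynomial (Fin n) k) where
  carrier := {p | ∀ m ∈ p.support, m ∈ U ∧ (m.degree : ℤ) = t}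
  zero_mem' := by simp
  add_mem' := by
    classical
    intro p q hp hq m hm
    rcases Finset.mem_union.1 (support_add hm) with h | h
    exacts [hp m h, hq m h]
  neg_mem' := by
    intro p hp m hm
    rw [support_neg] at hm
    exact hp m hm

/-- Vanishing of the `i`-th Koszul homology in multidegree `a` of the span of the monomials with
exponents in `U`. This is the reduced simplicial homology, in dimension `i - 1`, of the complex with
faces the `s` such that `x^a / x^s` is a monomial with exponent in `U`. -/
def SimplicialVanishes (k : Type*) [Field k] {n : ℕ} (U : Set (Fin n →₀ ℕ)) (a : Fin n →₀ ℕ)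
    (i : ℕ) : Prop :=
  ∀ g : Finset (Fin n) → k, (∀ s, g s ≠ 0 → indExp s ≤ a ∧ s.card = i ∧ a - indExp s ∈ U) →
    koszulD (1 : Fin n → k) g = 0 →
    ∃ f : Finset (Fin n) → k,
      (∀ s, f s ≠ 0 → indExp s ≤ a ∧ s.card = i + 1 ∧ a - indExp s ∈ U) ∧
      koszulD (1 : Fin n → k) f = g

theorem degree_sub_indExp {a : Fin n →₀ ℕ} {s : Finset (Fin n)} (h : indExp s ≤ a) :
    ((a - indExp s).degree : ℤ) = a.degree - s.card := by
  have := congrArg Finsupp.degree (tsub_add_cancel_of_le h)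
  rw [map_add, degree_indExp] at this
  omega

/-- The Koszul homology of a span of monomials splits into multidegrees. -/
theorem koszulVanishes_monomialPiece_iff {U : Set (Fin n →₀ ℕ)} {i : ℕ} {t : ℤ} :
    KoszulVanishes k n (monomialPiece k U) i t ↔
      ∀ a : Fin n →₀ ℕ, (a.degree : ℤ) = t + i → SimplicialVanishes k U a i := by
  constructor
  · intro H a ha g hg hgd
    have hs := slice_unslice_self (a := a) fun s h => (hg s h).1
    have hg1 : ∀ s, unslice a g s ∈ monomialPiece k U t := by
      intro s m hm
      rw [mem_support_iff, unslice, coeff_monomial] at hm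
      by_cases h1 : a - indExp s = m
      · rw [if_pos h1] at hm
        obtain ⟨h2, h3, h4⟩ := hg s hm
        rw [← h1]
        refine ⟨h4, ?_⟩
        rw [degree_sub_indExp h2]
        omega
      · rw [if_neg h1] at hm
        exact absurd rfl hm
    have hg2 : ∀ s, s.card ≠ i → unslice a g s = 0 := by
      intro s h
      have : g s = 0 := by
        by_contra h'
        exact h (hg s h').2.1
      rw [unslice, this, map_zero]
    have hg3 : koszulD (X : Fin n → MvPolynomial (Fin n) k) (unslice a g) = 0 := by
      refine slice_ext fun b => ?_
      rw [slice_koszulD, slice_zero]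
      by_cases hab : a = b
      · rw [← hab, hs, hgd]
      · rw [slice_unslice_of_ne hab fun s h => (hg s h).1, koszulD_zero]
    obtain ⟨b, hb, hb', hbd⟩ := H (unslice a g) hg1 hg2 hg3
    refine ⟨slice a b, fun s h => ?_, ?_⟩
    · obtain ⟨h1, h2⟩ := slice_ne_zero h
      refine ⟨h1, ?_, (hb s _ h2).1⟩
      by_contra h3
      rw [hb' s h3] at h2
      simp at h2
    · rw [← slice_koszulD, hbd, hs]
  · intro H c hc hc' hcd
    have key : ∀ a, slice a c ≠ 0 → ∃ f : Finset (Fin n) → k,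
        (∀ s, f s ≠ 0 → indExp s ≤ a ∧ (s.card = i + 1 ∧ a - indExp s ∈ U ∧
          ((a - indExp s).degree : ℤ) = t - 1)) ∧ koszulD (1 : Fin n → k) f = slice a c := by
      intro a ha
      have hsl : ∀ s, slice a c s ≠ 0 → indExp s ≤ a ∧ s.card = i ∧ a - indExp s ∈ U := by
        intro s hs
        obtain ⟨h1, h2⟩ := slice_ne_zero hs
        refine ⟨h1, ?_, (hc s _ h2).1⟩
        by_contra h3
        rw [hc' s h3] at h2
        simp at h2
      have hdeg : (a.degree : ℤ) = t + i := by
        obtain ⟨s, hs⟩ := Function.ne_iff.1 ha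
        obtain ⟨h1, h2⟩ := slice_ne_zero hs
        have h3 := (hc s _ h2).2
        rw [degree_sub_indExp h1, (hsl s hs).2.1] at h3
        omega
      obtain ⟨f, hf, hfd⟩ := H a hdeg (slice a c) hsl (by rw [← slice_koszulD, hcd, slice_zero])
      refine ⟨f, fun s hs => ?_, hfd⟩
      obtain ⟨h1, h2, h3⟩ := hf s hs
      refine ⟨h1, h2, h3, ?_⟩
      rw [degree_sub_indExp h1]
      omega
    obtain ⟨b, hb, hbd⟩ := exists_koszulD_eq_of_slices
        (P := fun s m => s.card = i + 1 ∧ m ∈ U ∧ (m.degree : ℤ) = t - 1) key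
    refine ⟨b, fun s m hm => (hb s m hm).2, fun s hs => ?_, hbd⟩
    rw [← support_eq_empty, Finset.eq_empty_iff_forall_notMem]
    exact fun m hm => hs (hb s m hm).1

theorem coneHomotopy_ne_zero {v : Fin n} {g : Finset (Fin n) → k} {s : Finset (Fin n)}
    (h : coneHomotopy v g s ≠ 0) : ∃ t, v ∉ t ∧ s = insert v t ∧ g t ≠ 0 := by
  unfold coneHomotopy at h
  by_cases hv : v ∈ s
  · rw [if_pos hv] at h
    exact ⟨s.erase v, Finset.notMem_erase v s, (Finset.insert_erase hv).symm,
      fun h' => h (by rw [h', smul_zero])⟩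
  · rw [if_neg hv] at h
    exact absurd rfl h

theorem indExp_insert_le {v : Fin n} {s : Finset (Fin n)} {a : Fin n →₀ ℕ} (hv : v ∉ s)
    (hs : indExp s ≤ a) (ha : a v ≠ 0) : indExp (insert v s) ≤ a := by
  intro w
  have := hs w
  rw [indExp_apply] at this ⊢
  by_cases h : w = v
  · subst h
    simp
    omega
  · simpa [h] using this

/-- If the complex in multidegree `a` contains, with each face of cardinality `i`, its join with a
fixed vertex `v`, then its homology vanishes in that degree. -/
theorem simplicialVanishes_of_cone {U : Set (Fin n →₀ ℕ)} {a : Fin n →₀ ℕ} {i : ℕ} {v : Fin n}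
    (hv : a v ≠ 0) (h : ∀ s, v ∉ s → indExp s ≤ a → s.card = i → a - indExp s ∈ U →
      a - indExp (insert v s) ∈ U) : SimplicialVanishes k U a i := by
  intro g hg hgd
  refine ⟨coneHomotopy v g, ?_, koszulD_coneHomotopy v hgd⟩
  intro s hs
  obtain ⟨t, ht, rfl, hgt⟩ := coneHomotopy_ne_zero hs
  obtain ⟨h1, h2, h3⟩ := hg t hgt
  exact ⟨indExp_insert_le ht h1 hv, by rw [Finset.card_insert_of_notMem ht, h2], h t ht h1 h2 h3⟩

/-- The Koszul complex on the polynomial ring is a resolution of `k`: a homogeneous cycle is a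
boundary, unless it is an element of `R` outside the maximal ideal. In a multidegree `a ≠ 0` the
complex is a full simplex on the support of `a`. -/
theorem exists_koszulD_eq_of_polynomial {c : Finset (Fin n) → MvPolynomial (Fin n) k} {i : ℕ}
    {t : ℤ} (hc : ∀ s, c s ∈ monomialPiece k Set.univ t) (hc' : ∀ s, s.card ≠ i → c s = 0)
    (hcd : koszulD (X : Fin n → MvPolynomial (Fin n) k) c = 0) (h0 : coeff 0 (c ∅) = 0) :
    ∃ b : Finset (Fin n) → MvPolynomial (Fin n) k, (∀ s, b s ∈ monomialPiece k Set.univ (t - 1)) ∧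
      (∀ s, s.card ≠ i + 1 → b s = 0) ∧ koszulD (X : Fin n → MvPolynomial (Fin n) k) b = c := by
  by_cases hz : t + i = 0
  · refine ⟨0, fun s => zero_mem _, fun s _ => rfl, ?_⟩
    rw [koszulD_zero]
    refine slice_ext fun a => ?_
    rw [slice_zero]
    funext s
    by_contra h
    obtain ⟨h1, h2⟩ := slice_ne_zero (Ne.symm h)
    have h3 := (hc s _ h2).2
    have h4 : s.card = i := by
      by_contra h4
      rw [hc' s h4] at h2
      simp at h2
    rw [degree_sub_indExp h1] at h3
    have ha : a = 0 := by
      rw [← Finsupp.degree_eq_zero_iff]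
      omega
    subst ha
    have hs : s = ∅ := by
      have := Finsupp.degree_mono h1
      rw [degree_indExp, map_zero] at this
      exact Finset.card_eq_zero.1 (by omega)
    subst hs
    rw [zero_tsub] at h2
    exact mem_support_iff.1 h2 h0
  · refine koszulVanishes_monomialPiece_iff.2 (fun a ha => ?_) c hc hc' hcd
    have hne : a ≠ 0 := by
      rintro rfl
      simp at ha
      omega
    obtain ⟨v, hv⟩ := Finsupp.ne_iff.1 hne
    exact simplicialVanishes_of_cone hv fun _ _ _ _ _ => Set.mem_univ _

end Slices

/-! ### Graded free modules -/

section GradedFree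

variable {k : Type*} [Field k] {n : ℕ}

/-- The homogeneous component of degree `e ∈ ℤ` of a polynomial. -/
noncomputable def homPart (e : ℤ) : MvPolynomial (Fin n) k →ₗ[k] MvPolynomial (Fin n) k :=
  if 0 ≤ e then homogeneousComponent e.toNat else 0

theorem coeff_homPart (e : ℤ) (m : Fin n →₀ ℕ) (p : MvPolynomial (Fin n) k) :
    coeff m (homPart e p) = if (m.degree : ℤ) = e then coeff m p else 0 := by
  unfold homPart
  by_cases he : 0 ≤ e
  · rw [if_pos he, coeff_homogeneousComponent]
    exact if_congr (by omega) rfl rfl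
  · rw [if_neg he, if_neg (by omega)]
    simp

theorem homPart_mem (e : ℤ) (p : MvPolynomial (Fin n) k) :
    homPart e p ∈ monomialPiece k Set.univ e := by
  intro m hm
  rw [mem_support_iff, coeff_homPart] at hm
  exact ⟨Set.mem_univ _, by by_contra h; rw [if_neg h] at hm; exact hm rfl⟩

theorem homPart_of_mem {e : ℤ} {p : MvPolynomial (Fin n) k}
    (hp : p ∈ monomialPiece k Set.univ e) : homPart e p = p := by
  ext m
  rw [coeff_homPart]
  by_cases h : m ∈ p.support
  · rw [if_pos (hp m h).2]
  · rw [notMem_support_iff.1 h, ite_self]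

theorem homPart_mul {s : ℤ} (e : ℤ) (p : MvPolynomial (Fin n) k) {q : MvPolynomial (Fin n) k}
    (hq : q ∈ monomialPiece k Set.univ s) : homPart e (p * q) = homPart (e - s) p * q := by
  classical
  ext m
  have h : ∀ x ∈ Finset.HasAntidiagonal.antidiagonal m,
      coeff x.1 (homPart (e - s) p) * coeff x.2 q =
        if (m.degree : ℤ) = e then coeff x.1 p * coeff x.2 q else 0 := by
    intro x hx
    rw [coeff_homPart]
    by_cases hx2 : x.2 ∈ q.support
    · have h1 := (hq _ hx2).2
      have h2 := congrArg Finsupp.degree (Finset.HasAntidiagonal.mem_antidiagonal.1 hx)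
      rw [map_add] at h2
      rw [ite_mul, zero_mul]
      exact if_congr (by omega) rfl rfl
    · simp [notMem_support_iff.1 hx2]
  rw [coeff_homPart, coeff_mul, coeff_mul, Finset.sum_congr rfl h]
  split_ifs
  · rfl
  · simp

theorem homPart_sum_mul {ι : Type*} [Fintype ι] (e : ℤ) (f q : ι → MvPolynomial (Fin n) k)
    {s : ι → ℤ} (hq : ∀ b, q b ∈ monomialPiece k Set.univ (s b)) :
    homPart e (∑ b, f b * q b) = ∑ b, homPart (e - s b) (f b) * q b := by
  rw [map_sum]
  exact Finset.sum_congr rfl fun b _ => homPart_mul e _ (hq b)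

/-- The piece of degree `e` of the graded free module `⨁ₐ R(-w a)`. -/
def freePiece (k : Type*) [Field k] (n : ℕ) {ι : Type*} (w : ι → ℤ) (e : ℤ) :
    AddSubgroup (ι → MvPolynomial (Fin n) k) where
  carrier := {f | ∀ a, f a ∈ monomialPiece k Set.univ (e - w a)}
  zero_mem' := fun _ => zero_mem _
  add_mem' := fun hf hg a => add_mem (hf a) (hg a)
  neg_mem' := fun hf a => neg_mem (hf a)

/-- The homogeneous component of degree `e` of an element of `⨁ₐ R(-w a)`. -/
noncomputable def vecPart {ι : Type*} (w : ι → ℤ) (e : ℤ) (f : ι → MvPolynomial (Fin n) k) :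
    ι → MvPolynomial (Fin n) k :=
  fun a => homPart (e - w a) (f a)

theorem vecPart_mem {ι : Type*} (w : ι → ℤ) (e : ℤ) (f : ι → MvPolynomial (Fin n) k) :
    vecPart w e f ∈ freePiece k n w e :=
  fun _ => homPart_mem _ _

theorem vecPart_of_mem {ι : Type*} {w : ι → ℤ} {e : ℤ} {f : ι → MvPolynomial (Fin n) k}
    (hf : f ∈ freePiece k n w e) : vecPart w e f = f :=
  funext fun a => homPart_of_mem (hf a)

theorem vecPart_mulVec {ι κ : Type*} [Fintype κ] {w' : ι → ℤ} {w : κ → ℤ}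
    {A : Matrix ι κ (MvPolynomial (Fin n) k)}
    (hA : ∀ a b, A a b ∈ monomialPiece k Set.univ (w b - w' a)) (e : ℤ)
    (f : κ → MvPolynomial (Fin n) k) :
    vecPart w' e (A.mulVec f) = A.mulVec (vecPart w e f) := by
  funext a
  simp only [vecPart, Matrix.mulVec, dotProduct, mul_comm (A a _)]
  rw [homPart_sum_mul _ _ _ (hA a)]
  refine Finset.sum_congr rfl fun b _ => ?_
  congr 3
  ring

theorem vecPart_sum {ι : Type*} [Fintype ι] (w : ι → ℤ) (f : ι → MvPolynomial (Fin n) k) :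
    ∃ E : Finset ℤ, ∑ e ∈ E, vecPart w e f = f := by
  classical
  refine ⟨Finset.univ.biUnion fun a => (f a).support.image fun m => (m.degree : ℤ) + w a, ?_⟩
  funext a
  ext m
  rw [Finset.sum_apply, coeff_sum]
  simp only [vecPart, coeff_homPart]
  by_cases hm : m ∈ (f a).support
  · rw [Finset.sum_eq_single ((m.degree : ℤ) + w a)]
    · rw [if_pos (by ring)]
    · intro e _ he
      rw [if_neg fun h => he (by rw [h]; ring)]
    · intro h
      exact absurd (Finset.mem_biUnion.2 ⟨a, Finset.mem_univ _, Finset.mem_image.2 ⟨m, hm, rfl⟩⟩) h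
  · simp [notMem_support_iff.1 hm]

theorem X_smul_mem_freePiece {ι : Type*} {w : ι → ℤ} {e : ℤ} {f : ι → MvPolynomial (Fin n) k}
    (hf : f ∈ freePiece k n w e) (v : Fin n) :
    (X v : MvPolynomial (Fin n) k) • f ∈ freePiece k n w (e + 1) := by
  classical
  intro a m hm
  rw [Pi.smul_apply, smul_eq_mul, mem_support_iff, coeff_X_mul'] at hm
  refine ⟨Set.mem_univ _, ?_⟩
  by_cases h : v ∈ m.support
  · rw [if_pos h] at hm
    have h1 := (hf a _ (mem_support_iff.2 hm)).2
    have h2 : Finsupp.single v 1 ≤ m :=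
      Finsupp.single_le_iff.2 (Nat.one_le_iff_ne_zero.2 (Finsupp.mem_support_iff.1 h))
    have h3 := congrArg Finsupp.degree (tsub_add_cancel_of_le h2)
    rw [map_add, Finsupp.degree_single] at h3
    omega
  · rw [if_neg h] at hm
    exact absurd rfl hm

theorem koszulD_mem_freePiece {ι : Type*} {w : ι → ℤ} {e : ℤ}
    {c : Finset (Fin n) → ι → MvPolynomial (Fin n) k} (hc : ∀ s, c s ∈ freePiece k n w e)
    (s : Finset (Fin n)) :
    koszulD (X : Fin n → MvPolynomial (Fin n) k) c s ∈ freePiece k n w (e + 1) :=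
  sum_mem fun v _ => zsmul_mem (X_smul_mem_freePiece (hc _) v) _

theorem coeff_zero_koszulD {ι : Type*} (c : Finset (Fin n) → ι → MvPolynomial (Fin n) k)
    (s : Finset (Fin n)) (a : ι) :
    coeff 0 (koszulD (X : Fin n → MvPolynomial (Fin n) k) c s a) = 0 := by
  rw [koszulD, Finset.sum_apply, coeff_sum]
  refine Finset.sum_eq_zero fun v _ => ?_
  rw [Pi.smul_apply, Pi.smul_apply, smul_eq_mul]
  have : coeff 0 (koszulSign v s • (X v * c (insert v s) a)) =
      koszulSign v s • coeff 0 (X v * c (insert v s) a) := map_zsmul (lcoeff k 0) _ _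
  rw [this, coeff_X_mul', if_neg (by simp), smul_zero]

/-- The Koszul complex on a graded free module `F` is acyclic: homogeneous cycles are boundaries,
except for elements of `F` outside `(x₁, …, xₙ) F`. -/
theorem exists_koszulD_eq_of_free {ι : Type*} {w : ι → ℤ} {i : ℕ} {t : ℤ}
    {c : Finset (Fin n) → ι → MvPolynomial (Fin n) k} (hc : ∀ s, c s ∈ freePiece k n w t)
    (hc' : ∀ s, s.card ≠ i → c s = 0)
    (hcd : koszulD (X : Fin n → MvPolynomial (Fin n) k) c = 0) (h0 : ∀ a, coeff 0 (c ∅ a) = 0) :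
    ∃ b : Finset (Fin n) → ι → MvPolynomial (Fin n) k, (∀ s, b s ∈ freePiece k n w (t - 1)) ∧
      (∀ s, s.card ≠ i + 1 → b s = 0) ∧ koszulD (X : Fin n → MvPolynomial (Fin n) k) b = c := by
  have hproj : ∀ (c : Finset (Fin n) → ι → MvPolynomial (Fin n) k) (a : ι),
      koszulD (X : Fin n → MvPolynomial (Fin n) k) (fun s => c s a) =
        fun s => koszulD (X : Fin n → MvPolynomial (Fin n) k) c s a := by
    intro c a
    funext s
    rw [koszulD, koszulD, Finset.sum_apply]
    rfl
  have hd : ∀ a, koszulD (X : Fin n → MvPolynomial (Fin n) k) (fun s => c s a) = 0 := by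
    intro a
    rw [hproj, hcd]
    rfl
  have h1 : ∀ s, s.card ≠ i → ∀ a, c s a = 0 := fun s hs a => congrFun (hc' s hs) a
  have key := fun a => exists_koszulD_eq_of_polynomial (c := fun s => c s a) (i := i)
    (t := t - w a) (fun s => hc s a) (fun s hs => h1 s hs a) (hd a) (h0 a)
  choose b hb hb' hbd using key
  refine ⟨fun s a => b a s, fun s a => ?_, fun s hs => funext fun a => hb' a s hs, ?_⟩
  · rw [sub_right_comm]
    exact hb a s
  · funext s a
    have := congrFun (hproj (fun s a => b a s) a) s
    rw [← this]
    exact congrFun (hbd a) s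

/-! ### Dimension shifting -/

/-- The graded pieces of the kernel of a linear map on a graded free module. -/
noncomputable def kerPiece {ι : Type*} {G : Type*} [AddCommGroup G]
    [Module (MvPolynomial (Fin n) k) G]
    (φ : (ι → MvPolynomial (Fin n) k) →ₗ[MvPolynomial (Fin n) k] G) (w : ι → ℤ) (e : ℤ) :
    AddSubgroup (ι → MvPolynomial (Fin n) k) :=
  freePiece k n w e ⊓ (LinearMap.ker φ).toAddSubgroup

/-- `φ` is a minimal cover of the graded module with pieces `ℳ` by the graded free module
`⨁ₐ R(-w a)`: it maps each graded piece onto the corresponding one, and its kernel lies in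
`(x₁, …, xₙ) F`. -/
structure IsMinimalCover {ι : Type*} {G : Type*} [AddCommGroup G]
    [Module (MvPolynomial (Fin n) k) G]
    (φ : (ι → MvPolynomial (Fin n) k) →ₗ[MvPolynomial (Fin n) k] G) (w : ι → ℤ)
    (ℳ : ℤ → AddSubgroup G) : Prop where
  map_mem : ∀ e f, f ∈ freePiece k n w e → φ f ∈ ℳ e
  exists_lift : ∀ e y, y ∈ ℳ e → ∃ f ∈ freePiece k n w e, φ f = y
  coeff_zero : ∀ f, φ f = 0 → ∀ a, coeff 0 (f a) = 0

variable {ι : Type*} {G : Type*} [AddCommGroup G] [Module (MvPolynomial (Fin n) k) G]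
    {φ : (ι → MvPolynomial (Fin n) k) →ₗ[MvPolynomial (Fin n) k] G} {w : ι → ℤ}
    {ℳ : ℤ → AddSubgroup G}

theorem IsMinimalCover.exists_lift_chain (h : IsMinimalCover φ w ℳ) {t : ℤ} {i : ℕ}
    {c : Finset (Fin n) → G} (hc : ∀ s, c s ∈ ℳ t) (hc' : ∀ s, s.card ≠ i → c s = 0) :
    ∃ b : Finset (Fin n) → ι → MvPolynomial (Fin n) k, (∀ s, b s ∈ freePiece k n w t) ∧
      (∀ s, s.card ≠ i → b s = 0) ∧ ∀ s, φ (b s) = c s := by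
  have : ∀ s, ∃ f : ι → MvPolynomial (Fin n) k, f ∈ freePiece k n w t ∧ (s.card ≠ i → f = 0) ∧
      φ f = c s := by
    intro s
    by_cases hs : s.card = i
    · obtain ⟨f, hf, hfc⟩ := h.exists_lift t _ (hc s)
      exact ⟨f, hf, fun h => absurd hs h, hfc⟩
    · exact ⟨0, zero_mem _, fun _ => rfl, by rw [map_zero, hc' s hs]⟩
  choose b hb hb' hbc using this
  exact ⟨b, hb, hb', hbc⟩

/-- Koszul homology shifts along a minimal cover, since the Koszul complex of a free module is
acyclic. -/
theorem IsMinimalCover.koszulVanishes_succ_iff (h : IsMinimalCover φ w ℳ) (i : ℕ) (t : ℤ) :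
    KoszulVanishes k n ℳ (i + 1) t ↔ KoszulVanishes k n (kerPiece φ w) i (t + 1) := by
  constructor
  · intro H z hz hz' hzd
    -- For `i = 0`, minimality puts `z` into `(x₁, …, xₙ) F`, so that it is a boundary in `F`.
    obtain ⟨f, hf, hf', hfd⟩ := exists_koszulD_eq_of_free (fun s => (hz s).1) hz' hzd
      (h.coeff_zero _ (hz ∅).2)
    rw [add_sub_cancel_right] at hf
    obtain ⟨m, hm, hm', hmd⟩ := H (fun s => φ (f s)) (fun s => h.map_mem _ _ (hf s))
      (fun s hs => by rw [hf' s hs, map_zero])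
      (by rw [koszulD_comp, hfd]; exact funext fun s => (hz s).2)
    obtain ⟨b, hb, hb', hbm⟩ := h.exists_lift_chain hm hm'
    refine ⟨f - koszulD (X : Fin n → MvPolynomial (Fin n) k) b, fun s => ⟨?_, ?_⟩,
      fun s hs => ?_, ?_⟩
    · rw [add_sub_cancel_right]
      have := koszulD_mem_freePiece hb s
      rw [sub_add_cancel] at this
      exact (freePiece k n w t).sub_mem (hf s) this
    · have h1 := koszulD_comp (X : Fin n → MvPolynomial (Fin n) k) φ b
      rw [show (fun s => φ (b s)) = m from funext hbm, hmd] at h1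
      have h2 : φ (f s) = φ (koszulD (X : Fin n → MvPolynomial (Fin n) k) b s) := congrFun h1 s
      show φ (f s - koszulD (X : Fin n → MvPolynomial (Fin n) k) b s) = 0
      rw [map_sub, h2, sub_self]
    · rw [Pi.sub_apply, hf' s hs, koszulD_apply_eq_zero _ hb' hs, sub_zero]
    · rw [koszulD_sub, hfd, koszulD_koszulD, sub_zero]
  · intro H c hc hc' hcd
    obtain ⟨l, hl, hl', hlc⟩ := h.exists_lift_chain hc hc'
    obtain ⟨e, he, he', hed⟩ := H (koszulD X l)
      (fun s => ⟨koszulD_mem_freePiece hl s, by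
        have := congrFun (koszulD_comp (X : Fin n → MvPolynomial (Fin n) k) φ l) s
        rw [show (fun s => φ (l s)) = c from funext hlc, hcd] at this
        exact this.symm⟩)
      (fun s hs => koszulD_apply_eq_zero _ hl' hs) (koszulD_koszulD _ _)
    have hle' : ∀ s, s.card ≠ i + 1 → (l - e) s = 0 := fun s hs => by
      rw [Pi.sub_apply, hl' s hs, he' s hs, sub_zero]
    obtain ⟨b, hb, hb', hbd⟩ := exists_koszulD_eq_of_free (c := l - e) (t := t) (w := w)
      (fun s => sub_mem (hl s) (by have := (he s).1; rwa [add_sub_cancel_right] at this))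
      hle' (by rw [koszulD_sub, hed, sub_self])
      (fun a => by rw [hle' ∅ (by simp)]; simp)
    refine ⟨fun s => φ (b s), fun s => h.map_mem _ _ (hb s),
      fun s hs => (congrArg φ (hb' s hs)).trans (map_zero φ), ?_⟩
    rw [koszulD_comp, hbd]
    funext s
    have : φ (e s) = 0 := (he s).2
    rw [Pi.sub_apply, map_sub, hlc, this, sub_zero]

theorem koszulD_eq_zero_of_card {M : Type*} [AddCommGroup M] [Module (MvPolynomial (Fin n) k) M]
    {c : Finset (Fin n) → M} (hc : ∀ s, s.card ≠ 0 → c s = 0) :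
    koszulD (X : Fin n → MvPolynomial (Fin n) k) c = 0 := by
  funext s
  refine Finset.sum_eq_zero fun v hv => ?_
  rw [hc _ (by simp), smul_zero, smul_zero]

/-- Koszul homology in homological degree `0` counts the generators of a minimal cover. -/
theorem IsMinimalCover.koszulVanishes_zero_iff (h : IsMinimalCover φ w ℳ) (t : ℤ) :
    KoszulVanishes k n ℳ 0 t ↔ ∀ a, w a ≠ t := by
  classical
  constructor
  · intro H a ha
    have hea : (Pi.single a 1 : ι → MvPolynomial (Fin n) k) ∈ freePiece k n w t := by
      intro b
      by_cases hb : b = a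
      · subst hb
        rw [Pi.single_eq_same, ha, sub_self]
        intro m hm
        rw [mem_support_iff, coeff_one] at hm
        refine ⟨Set.mem_univ _, ?_⟩
        by_cases h0 : 0 = m
        · rw [← h0]; simp
        · rw [if_neg h0] at hm; exact absurd rfl hm
      · rw [Pi.single_eq_of_ne hb]
        exact zero_mem _
    have hc' : ∀ s : Finset (Fin n), s.card ≠ 0 →
        (if s = ∅ then φ (Pi.single a 1) else 0) = 0 := fun s hs =>
      if_neg fun h => hs (by rw [h]; rfl)
    obtain ⟨b, hb, hb', hbd⟩ := H (fun s => if s = ∅ then φ (Pi.single a 1) else 0)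
      (fun s => by
        split_ifs
        exacts [h.map_mem _ _ hea, zero_mem _]) hc' (koszulD_eq_zero_of_card hc')
    obtain ⟨l, hl, hl', hlb⟩ := h.exists_lift_chain hb hb'
    have h1 := congrFun (koszulD_comp (X : Fin n → MvPolynomial (Fin n) k) φ l) ∅
    rw [show (fun s => φ (l s)) = b from funext hlb, hbd] at h1
    dsimp only at h1
    rw [if_pos rfl, ← sub_eq_zero, ← map_sub] at h1
    have h2 := h.coeff_zero _ h1 a
    rw [Pi.sub_apply, coeff_sub, coeff_zero_koszulD, Pi.single_eq_same, coeff_zero_one,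
      sub_zero] at h2
    exact one_ne_zero h2
  · intro H c hc hc' _
    obtain ⟨l, hl, hl', hlc⟩ := h.exists_lift_chain hc hc'
    obtain ⟨b, hb, hb', hbd⟩ := exists_koszulD_eq_of_free hl hl' (koszulD_eq_zero_of_card hl')
      (fun a => by
        by_contra h0
        have := (hl ∅ a 0 (mem_support_iff.2 h0)).2
        rw [map_zero, Nat.cast_zero] at this
        exact H a (by omega))
    refine ⟨fun s => φ (b s), fun s => h.map_mem _ _ (hb s),
      fun s hs => (congrArg φ (hb' s hs)).trans (map_zero φ), ?_⟩
    rw [koszulD_comp, hbd]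
    exact funext hlc

end GradedFree

/-! ### Betti numbers and Koszul homology -/

section Betti

universe u

variable {k : Type u} [Field k] {n : ℕ}

/-- The homogeneous elements of degree `e` of an ideal. -/
noncomputable def idealPiece (J : Ideal (MvPolynomial (Fin n) k)) (e : ℤ) :
    AddSubgroup (MvPolynomial (Fin n) k) :=
  J.toAddSubgroup ⊓ monomialPiece k Set.univ e

theorem mem_idealOfVars_iff (p : MvPolynomial (Fin n) k) :
    p ∈ Ideal.span (Set.range (X : Fin n → MvPolynomial (Fin n) k)) ↔ coeff 0 p = 0 := by
  have := mem_pow_idealOfVars_iff' (σ := Fin n) (R := k) 1 p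
  rw [pow_one] at this
  refine this.trans ⟨fun h => h 0 (by simp), fun h x hx => ?_⟩
  rw [(Finsupp.degree_eq_zero_iff x).1 (by omega), h]

theorem coeff_zero_mulVec {ι κ : Type*} [Fintype κ] {A : Matrix ι κ (MvPolynomial (Fin n) k)}
    (hA : ∀ a b, coeff 0 (A a b) = 0) (f : κ → MvPolynomial (Fin n) k) (a : ι) :
    coeff 0 (A.mulVec f a) = 0 := by
  rw [Matrix.mulVec, dotProduct, coeff_sum]
  refine Finset.sum_eq_zero fun b _ => ?_
  have := hA a b
  rw [← constantCoeff_eq] at this ⊢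
  rw [map_mul, this, zero_mul]

variable {J : Ideal (MvPolynomial (Fin n) k)}

namespace MinimalGradedFreeResolution

theorem isMinimalCover_gen (F : MinimalGradedFreeResolution J) :
    IsMinimalCover (Fintype.linearCombination (MvPolynomial (Fin n) k) F.gen) (F.deg 0)
      (idealPiece J) := by
  have hgen : ∀ b, F.gen b ∈ monomialPiece k Set.univ (F.deg 0 b) :=
    fun b m hm => ⟨Set.mem_univ _, F.gen_homogeneous b m hm⟩
  have hrange : LinearMap.range (Fintype.linearCombination (MvPolynomial (Fin n) k) F.gen) = J := by
    rw [Fintype.range_linearCombination]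
    exact F.span_gen
  have hpart : ∀ e f, Fintype.linearCombination (MvPolynomial (Fin n) k) F.gen
      (vecPart (F.deg 0) e f) =
      homPart e (Fintype.linearCombination (MvPolynomial (Fin n) k) F.gen f) := by
    intro e f
    simp only [Fintype.linearCombination_apply, smul_eq_mul]
    rw [homPart_sum_mul _ _ _ hgen]
    rfl
  refine ⟨fun e f hf => ⟨?_, ?_⟩, fun e y hy => ?_, fun f hf a => ?_⟩
  · exact hrange.le ⟨f, rfl⟩
  · rw [← vecPart_of_mem hf, hpart]
    exact homPart_mem _ _
  · obtain ⟨h1, h2⟩ := hy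
    obtain ⟨f, rfl⟩ := hrange.ge h1
    exact ⟨_, vecPart_mem _ e f, by rw [hpart, homPart_of_mem h2]⟩
  · have : f ∈ LinearMap.range (F.d 0).mulVecLin := by rw [← F.exact_zero]; exact hf
    obtain ⟨g, rfl⟩ := this
    exact coeff_zero_mulVec (fun a b => (mem_idealOfVars_iff _).1 (F.minimal 0 a b)) g a

theorem isMinimalCover_d (F : MinimalGradedFreeResolution J) (s : ℕ) {G : Type*} [AddCommGroup G]
    [Module (MvPolynomial (Fin n) k) G]
    {φ : (Fin (F.rank s) → MvPolynomial (Fin n) k) →ₗ[MvPolynomial (Fin n) k] G}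
    (hφ : LinearMap.ker φ = LinearMap.range (F.d s).mulVecLin) :
    IsMinimalCover (F.d s).mulVecLin (F.deg (s + 1)) (kerPiece φ (F.deg s)) := by
  have hd : ∀ a b, F.d s a b ∈ monomialPiece k Set.univ (F.deg (s + 1) b - F.deg s a) :=
    fun a b m hm => ⟨Set.mem_univ _, by have := F.d_homogeneous s a b m hm; omega⟩
  refine ⟨fun e f hf => ⟨?_, ?_⟩, fun e y hy => ?_, fun f hf a => ?_⟩
  · rw [← vecPart_of_mem hf, Matrix.mulVecLin_apply, ← vecPart_mulVec hd]
    exact vecPart_mem _ _ _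
  · show _ ∈ LinearMap.ker φ
    rw [hφ]
    exact ⟨f, rfl⟩
  · obtain ⟨h1, h2⟩ := hy
    have h2 : y ∈ LinearMap.ker φ := h2
    rw [hφ] at h2
    obtain ⟨f, rfl⟩ := h2
    refine ⟨_, vecPart_mem _ e f, ?_⟩
    rw [Matrix.mulVecLin_apply, ← vecPart_mulVec hd]
    exact vecPart_of_mem h1
  · have : f ∈ LinearMap.range (F.d (s + 1)).mulVecLin := by rw [← F.exact_succ]; exact hf
    obtain ⟨g, rfl⟩ := this
    exact coeff_zero_mulVec (fun a b => (mem_idealOfVars_iff _).1 (F.minimal (s + 1) a b)) g a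

/-- Along a minimal resolution, the `i`-th Koszul homology of the `s`-th syzygy module counts basis
elements in homological degree `s + i + 1`. Each shift raises the internal degree by one. -/
theorem koszulVanishes_kerPiece_iff (F : MinimalGradedFreeResolution J) (i : ℕ) :
    ∀ {s j : ℕ} (t : ℤ) {G : Type u} [AddCommGroup G] [Module (MvPolynomial (Fin n) k) G]
    {φ : (Fin (F.rank s) → MvPolynomial (Fin n) k) →ₗ[MvPolynomial (Fin n) k] G},
    LinearMap.ker φ = LinearMap.range (F.d s).mulVecLin → j = s + i + 1 →
    (KoszulVanishes k n (kerPiece φ (F.deg s)) i t ↔ ∀ a, F.deg j a ≠ t + i) := by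
  induction i with
  | zero =>
    intro s j t G _ _ φ hφ hj
    subst hj
    rw [(F.isMinimalCover_d s hφ).koszulVanishes_zero_iff]
    simp
  | succ i ih =>
    intro s j t G _ _ φ hφ hj
    rw [(F.isMinimalCover_d s hφ).koszulVanishes_succ_iff,
      ih (t + 1) (F.exact_succ s) (j := j) (by omega)]
    push_cast
    rw [show t + 1 + (i : ℤ) = t + (i + 1) by ring]

/-- The graded Betti numbers of `J` are detected by the Koszul homology of `J`. -/
theorem betti_eq_zero_iff (F : MinimalGradedFreeResolution J) (i : ℕ) (t : ℤ) :
    F.betti i (i + t) = 0 ↔ KoszulVanishes k n (idealPiece J) i t := by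
  have hb : ∀ j, F.betti i j = 0 ↔ ∀ a, F.deg i a ≠ j := by
    intro j
    rw [betti, Fintype.card_eq_zero_iff, isEmpty_subtype]
  rw [hb]
  cases i with
  | zero =>
    rw [F.isMinimalCover_gen.koszulVanishes_zero_iff]
    simp
  | succ i =>
    rw [F.isMinimalCover_gen.koszulVanishes_succ_iff,
      F.koszulVanishes_kerPiece_iff i (t + 1) F.exact_zero (j := i + 1) (by omega)]
    push_cast
    rw [show (i : ℤ) + 1 + t = t + 1 + i by ring]

end MinimalGradedFreeResolution

end Betti

/-! ### Existence of minimal graded free resolutions -/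

section Existence

variable {k : Type*} [Field k] {n : ℕ}

theorem range_mulVecLin_eq_span {ι κ : Type*} [Fintype κ]
    (g : κ → ι → MvPolynomial (Fin n) k) :
    LinearMap.range (Matrix.of fun a b => g b a).mulVecLin =
      Submodule.span (MvPolynomial (Fin n) k) (Set.range g) := by
  rw [Matrix.range_mulVecLin]
  rfl

/-- The homogeneous components of finitely many generators of a graded submodule generate it. -/
theorem exists_homogeneous_generators {ι : Type*} [Fintype ι] (w' : ι → ℤ)
    (Z : Submodule (MvPolynomial (Fin n) k) (ι → MvPolynomial (Fin n) k))
    (hZ : ∀ f ∈ Z, ∀ e, vecPart w' e f ∈ Z) :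
    ∃ (N : ℕ) (w : Fin N → ℤ) (g : Fin N → ι → MvPolynomial (Fin n) k),
      (∀ b, g b ∈ freePiece k n w' (w b)) ∧
        Submodule.span (MvPolynomial (Fin n) k) (Set.range g) = Z := by
  classical
  obtain ⟨S, hS⟩ : Z.FG := IsNoetherian.noetherian Z
  choose E hE using vecPart_sum (k := k) (n := n) w'
  let T : Finset (ℤ × (ι → MvPolynomial (Fin n) k)) := S.sigma E |>.image
    fun p => (p.2, vecPart w' p.2 p.1)
  refine ⟨T.card, fun b => (T.equivFin.symm b).1.1, fun b => (T.equivFin.symm b).1.2, ?_, ?_⟩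
  · intro b
    obtain ⟨p, _, hp⟩ := Finset.mem_image.1 (T.equivFin.symm b).2
    dsimp only
    rw [← hp]
    exact vecPart_mem _ _ _
  · apply le_antisymm
    · rw [Submodule.span_le]
      rintro _ ⟨b, rfl⟩
      obtain ⟨p, hp1, hp⟩ := Finset.mem_image.1 (T.equivFin.symm b).2
      dsimp only
      rw [← hp]
      refine hZ _ ?_ _
      rw [← hS]
      exact Submodule.subset_span (Finset.mem_sigma.1 hp1).1
    · conv_lhs => rw [← hS]
      rw [Submodule.span_le]
      intro f hf
      rw [← hE f]
      refine sum_mem fun e he => Submodule.subset_span ?_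
      have hT : (e, vecPart w' e f) ∈ T :=
        Finset.mem_image.2 ⟨⟨f, e⟩, Finset.mem_sigma.2 ⟨hf, he⟩, rfl⟩
      exact ⟨T.equivFin ⟨_, hT⟩, by simp⟩

/-- A homogeneous generating set with the least number of elements is minimal: by comparing
components of a suitable degree, a relation with a coefficient outside `(x₁, …, xₙ)` would make one
of the generators superfluous. -/
theorem exists_minimal_generators {ι : Type*} [Fintype ι] (w' : ι → ℤ)
    (Z : Submodule (MvPolynomial (Fin n) k) (ι → MvPolynomial (Fin n) k))
    (hZ : ∀ f ∈ Z, ∀ e, vecPart w' e f ∈ Z) :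
    ∃ (N : ℕ) (w : Fin N → ℤ) (A : Matrix ι (Fin N) (MvPolynomial (Fin n) k)),
      (∀ a b, A a b ∈ monomialPiece k Set.univ (w b - w' a)) ∧
        LinearMap.range A.mulVecLin = Z ∧ ∀ f, A.mulVec f = 0 → ∀ b, coeff 0 (f b) = 0 := by
  classical
  have hex := exists_homogeneous_generators w' Z hZ
  obtain ⟨w, g, hg, hgZ⟩ := Nat.find_spec hex
  have hmin := fun {m} => Nat.find_min hex (m := m)
  generalize Nat.find hex = N at w g hmin
  have hA : ∀ a b, (Matrix.of fun a b => g b a) a b ∈ monomialPiece k Set.univ (w b - w' a) :=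
    fun a b => hg b a
  refine ⟨N, w, Matrix.of fun a b => g b a, hA, by rw [range_mulVecLin_eq_span, hgZ], ?_⟩
  intro f hf b₀
  by_contra hne
  obtain ⟨M, rfl⟩ : ∃ M, N = M + 1 := ⟨N - 1, by have := b₀.2; omega⟩
  -- In the degree of `g b₀`, the coefficient of `g b₀` in the relation is a nonzero constant.
  have hf' := vecPart_mulVec hA (w b₀) f
  rw [hf] at hf'
  have h0 : vecPart w' (w b₀) (0 : ι → MvPolynomial (Fin n) k) = 0 :=
    funext fun a => map_zero _
  rw [h0] at hf'
  have hsum : ∑ b, vecPart w (w b₀) f b • g b = 0 := by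
    rw [hf']
    funext a
    simp [Matrix.mulVec, dotProduct, Finset.sum_apply, mul_comm]
  have hb₀ : vecPart w (w b₀) f b₀ = C (coeff 0 (f b₀)) := by
    ext m
    rw [vecPart, coeff_homPart, coeff_C, sub_self]
    by_cases hm : 0 = m
    · subst hm; simp
    · rw [if_neg hm, if_neg]
      intro h
      exact hm ((Finsupp.degree_eq_zero_iff m).1 (by exact_mod_cast h)).symm
  rw [Fin.sum_univ_succAbove _ b₀, hb₀] at hsum
  have hmem : g b₀ ∈ Submodule.span (MvPolynomial (Fin n) k)
      (Set.range fun b => g (b₀.succAbove b)) := by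
    have h1 : g b₀ = (C (coeff 0 (f b₀))⁻¹ : MvPolynomial (Fin n) k) •
        (C (coeff 0 (f b₀)) : MvPolynomial (Fin n) k) • g b₀ := by
      rw [smul_smul, ← C_mul, inv_mul_cancel₀ hne, C_1, one_smul]
    rw [h1, eq_neg_of_add_eq_zero_left hsum]
    exact Submodule.smul_mem _ _ (neg_mem (sum_mem fun b _ =>
      Submodule.smul_mem _ _ (Submodule.subset_span ⟨b, rfl⟩)))
  refine hmin (Nat.lt_succ_self M) ⟨fun b => w (b₀.succAbove b), fun b => g (b₀.succAbove b),
    fun b => hg _, ?_⟩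
  rw [← hgZ]
  refine le_antisymm (Submodule.span_mono ?_) (Submodule.span_le.2 ?_)
  · rintro _ ⟨b, rfl⟩
    exact ⟨_, rfl⟩
  · rintro _ ⟨b, rfl⟩
    by_cases hb : b = b₀
    · subst hb
      exact hmem
    · obtain ⟨b', rfl⟩ := Fin.exists_succAbove_eq hb
      exact Submodule.subset_span ⟨b', rfl⟩

/-- A step in the construction of a minimal graded free resolution: a graded free module
`F = ⨁ₐ R(-deg a)`, together with the graded submodule of `(x₁, …, xₙ) F` that is to be resolved
next. -/
structure SyzygyStage (k : Type*) [Field k] (n : ℕ) where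
  /-- the rank of the free module -/
  rank : ℕ
  /-- the degrees of the basis elements -/
  deg : Fin rank → ℤ
  /-- the module of relations -/
  rel : Submodule (MvPolynomial (Fin n) k) (Fin rank → MvPolynomial (Fin n) k)
  graded : ∀ f ∈ rel, ∀ e, vecPart deg e f ∈ rel
  minimal : ∀ f ∈ rel, ∀ a, coeff 0 (f a) = 0

/-- A graded submodule of a graded free module is minimally generated by the columns of a matrix, the
relations among which make up the next stage. -/
theorem exists_stage_covering {ι : Type*} [Fintype ι] (w' : ι → ℤ)
    (Z : Submodule (MvPolynomial (Fin n) k) (ι → MvPolynomial (Fin n) k))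
    (hZ : ∀ f ∈ Z, ∀ e, vecPart w' e f ∈ Z) :
    ∃ (T : SyzygyStage k n) (A : Matrix ι (Fin T.rank) (MvPolynomial (Fin n) k)),
      (∀ a b, A a b ∈ monomialPiece k Set.univ (T.deg b - w' a)) ∧
        LinearMap.range A.mulVecLin = Z ∧ LinearMap.ker A.mulVecLin = T.rel := by
  obtain ⟨N, w, A, hA, hAZ, hmin⟩ := exists_minimal_generators w' Z hZ
  refine ⟨⟨N, w, LinearMap.ker A.mulVecLin, fun f hf e => ?_, fun f hf a => hmin f hf a⟩, A, hA,
    hAZ, rfl⟩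
  have h : A.mulVec f = 0 := hf
  show A.mulVec (vecPart w e f) = 0
  rw [← vecPart_mulVec hA, h]
  exact funext fun a => map_zero _

/-- A minimal graded free resolution is built by covering minimally the relations found so far, over
and over again. -/
theorem exists_minimalGradedFreeResolution (J : Ideal (MvPolynomial (Fin n) k))
    (hJ : ∀ p ∈ J, ∀ e, homPart e p ∈ J) : Nonempty (MinimalGradedFreeResolution J) := by
  let Z : Submodule (MvPolynomial (Fin n) k) (Fin 1 → MvPolynomial (Fin n) k) :=
    Submodule.comap (LinearMap.proj 0) J
  obtain ⟨T, A, hA, hAJ, hAT⟩ := exists_stage_covering (fun _ : Fin 1 => (0 : ℤ)) Z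
    (fun f hf e => hJ _ hf _)
  choose next B hB hBr hBk using fun S : SyzygyStage k n =>
    exists_stage_covering S.deg S.rel S.graded
  let S : ℕ → SyzygyStage k n := fun i => Nat.rec T (fun _ S => next S) i
  have hlin : ∀ f, Fintype.linearCombination (MvPolynomial (Fin n) k) (A 0) f = A.mulVec f 0 := by
    intro f
    simp [Fintype.linearCombination_apply, Matrix.mulVec, dotProduct, mul_comm]
  exact ⟨{
    rank := fun i => (S i).rank
    deg := fun i => (S i).deg
    gen := A 0
    d := fun i => B (S i)
    gen_homogeneous := fun a m hm => by
      have := (hA 0 a m hm).2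
      rwa [sub_zero] at this
    d_homogeneous := fun i a b m hm => by
      have := (hB (S i) a b m hm).2
      show (m.degree : ℤ) + (S i).deg a = (next (S i)).deg b
      omega
    span_gen := by
      show Submodule.span _ (Set.range (A 0)) = J
      rw [← Fintype.range_linearCombination]
      ext p
      constructor
      · rintro ⟨f, rfl⟩
        rw [hlin]
        exact hAJ.le ⟨f, rfl⟩
      · intro hp
        obtain ⟨f, hf⟩ := hAJ.ge (show (fun _ => p) ∈ Z from hp)
        exact ⟨f, by rw [hlin]; exact congrFun hf 0⟩
    exact_zero := by
      refine Eq.trans ?_ (hBr T).symm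
      rw [← hAT]
      ext f
      rw [LinearMap.mem_ker, LinearMap.mem_ker, hlin, Matrix.mulVecLin_apply]
      exact ⟨fun h => funext fun j => by rw [Subsingleton.elim j 0]; exact h,
        fun h => congrFun h 0⟩
    exact_succ := fun i => (hBk (S i)).trans (hBr (S (i + 1))).symm
    minimal := fun i a b => by
      rw [mem_idealOfVars_iff]
      have h : (B (S i)).mulVec (Pi.single b 1) ∈ (S i).rel := (hBr (S i)).le ⟨_, rfl⟩
      have := (S i).minimal _ h a
      rwa [Matrix.mulVec_single_one] at this }⟩

end Existence

/-! ### Ideals spanned by monomials, generated in one degree -/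

section Monomial

universe u

variable {k : Type u} [Field k] {n : ℕ}

theorem idealPiece_eq_monomialPiece {J : Ideal (MvPolynomial (Fin n) k)} {U : Set (Fin n →₀ ℕ)}
    (hJ : ∀ p, p ∈ J ↔ ∀ m ∈ p.support, m ∈ U) : idealPiece J = monomialPiece k U := by
  funext e
  ext p
  refine ⟨fun h m hm => ⟨(hJ p).1 h.1 m hm, (h.2 m hm).2⟩,
    fun h => ⟨(hJ p).2 fun m hm => (h m hm).1, fun m hm => ⟨Set.mem_univ _, (h m hm).2⟩⟩⟩

theorem simplicialVanishes_of_no_face {U : Set (Fin n →₀ ℕ)} {a : Fin n →₀ ℕ} {i : ℕ}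
    (h : ∀ s, indExp s ≤ a → s.card = i → a - indExp s ∉ U) : SimplicialVanishes k U a i := by
  intro g hg _
  refine ⟨0, fun s hs => absurd rfl hs, ?_⟩
  rw [koszulD_zero]
  funext s
  by_contra hs
  obtain ⟨h1, h2, h3⟩ := hg s (Ne.symm hs)
  exact h s h1 h2 h3

theorem simplicialVanishes_congr {U V : Set (Fin n →₀ ℕ)} {a : Fin n →₀ ℕ}
    (h : ∀ m ≤ a, m ∈ U ↔ m ∈ V) (i : ℕ) :
    SimplicialVanishes k U a i ↔ SimplicialVanishes k V a i := by
  have h' : ∀ s : Finset (Fin n), a - indExp s ∈ U ↔ a - indExp s ∈ V := fun s => h _ tsub_le_self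
  simp only [SimplicialVanishes, h']

/-- A monomial of least degree is a minimal generator. -/
theorem not_simplicialVanishes_zero {U : Set (Fin n →₀ ℕ)} {m : Fin n →₀ ℕ} (hm : m ∈ U)
    (hU : ∀ m' ∈ U, m.degree ≤ m'.degree) : ¬ SimplicialVanishes k U m 0 := by
  intro H
  have hz : indExp (∅ : Finset (Fin n)) = 0 := by simp [indExp]
  let g : Finset (Fin n) → k := fun s => if s = ∅ then 1 else 0
  have hg : ∀ s, g s ≠ 0 → s = ∅ := fun s hs => by
    by_contra h
    exact hs (if_neg h)
  obtain ⟨f, hf, hfd⟩ := H g (fun s hs => by rw [hg s hs, hz]; simpa using hm) (by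
    funext s
    refine Finset.sum_eq_zero fun v _ => ?_
    rw [show g (insert v s) = 0 from if_neg (by simp), smul_zero, smul_zero])
  have hf0 : f = 0 := by
    funext s
    by_contra hs
    obtain ⟨h1, h2, h3⟩ := hf s hs
    have h4 := hU _ h3
    have h5 := degree_sub_indExp h1
    omega
  rw [hf0, koszulD_zero] at hfd
  have := congrFun hfd ∅
  exact one_ne_zero (this.symm.trans rfl : (1 : k) = 0)

/-- For an ideal spanned by monomials and generated in degree `j`, linearity in the first `r` steps
means vanishing of the Koszul homology off the internal degree `j`. -/
theorem isLinearInFirstSteps_iff {J : Ideal (MvPolynomial (Fin n) k)} {U : Set (Fin n →₀ ℕ)}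
    (hJ : ∀ p, p ∈ J ↔ ∀ m ∈ p.support, m ∈ U) {j : ℕ}
    (hU : ∀ m ∈ U, ∃ m' ∈ U, m' ≤ m ∧ m'.degree = j) (r : ℕ) :
    IsLinearInFirstSteps r J ↔
      ∀ i < r, ∀ t : ℤ, t ≠ j → ∀ a : Fin n →₀ ℕ, (a.degree : ℤ) = t + i →
        SimplicialVanishes k U a i := by
  simp only [← koszulVanishes_monomialPiece_iff]
  constructor
  · rintro ⟨F, d, hF⟩ i hi t ht
    by_cases hd : d = j
    · have := hF i hi t (by rwa [hd])
      rwa [F.betti_eq_zero_iff, idealPiece_eq_monomialPiece hJ] at this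
    · -- With `d ≠ j` there are no generators of degree `j`, so the ideal is zero.
      have h0 := hF 0 (by omega) j (Ne.symm hd)
      rw [F.betti_eq_zero_iff, idealPiece_eq_monomialPiece hJ,
        koszulVanishes_monomialPiece_iff] at h0
      have hempty : ∀ m, m ∉ U := by
        intro m hm
        obtain ⟨m', hm', _, hdeg⟩ := hU m hm
        refine not_simplicialVanishes_zero hm' (fun m₂ hm₂ => ?_) (h0 m' (by simp [hdeg]))
        obtain ⟨m₃, _, hle, hdeg₃⟩ := hU m₂ hm₂
        rw [hdeg, ← hdeg₃]
        exact Finsupp.degree_mono hle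
      exact koszulVanishes_monomialPiece_iff.2 fun a _ =>
        simplicialVanishes_of_no_face fun s _ _ => hempty _
  · intro H
    obtain ⟨F⟩ := exists_minimalGradedFreeResolution J fun p hp e => (hJ _).2 fun m hm => by
      rw [mem_support_iff, coeff_homPart] at hm
      refine (hJ p).1 hp m (mem_support_iff.2 fun h => hm ?_)
      rw [h, ite_self]
    refine ⟨F, j, fun i hi t ht => ?_⟩
    rw [F.betti_eq_zero_iff, idealPiece_eq_monomialPiece hJ]
    exact H i hi t ht

/-! ### The components of a squarefree monomial ideal -/

/-- The exponents of the monomials in the squarefree monomial ideal generated by `S`. -/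
def expSet {n : ℕ} (S : Set (Finset (Fin n))) : Set (Fin n →₀ ℕ) :=
  {m | ∃ s ∈ S, indExp s ≤ m}

/-- The exponents of the monomials in the component `I_{<j>}` of the ideal `I` generated by `S`. -/
def componentExpSet {n : ℕ} (S : Set (Finset (Fin n))) (j : ℕ) : Set (Fin n →₀ ℕ) :=
  {m | ∃ m' ∈ expSet S, m'.degree = j ∧ m' ≤ m}

/-- The exponents of the monomials in the component `I_{[j]}` of the ideal `I` generated by `S`. -/
def squarefreeComponentExpSet {n : ℕ} (S : Set (Finset (Fin n))) (j : ℕ) : Set (Fin n →₀ ℕ) :=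
  {m | ∃ s : Finset (Fin n), indExp s ∈ expSet S ∧ s.card = j ∧ indExp s ≤ m}

theorem mem_span_squarefreeMonomial_iff (S : Set (Finset (Fin n))) (p : MvPolynomial (Fin n) k) :
    p ∈ Ideal.span (squarefreeMonomial k '' S) ↔ ∀ m ∈ p.support, m ∈ expSet S := by
  have : squarefreeMonomial k '' S = (fun m => monomial m (1 : k)) '' (indExp '' S) := by
    rw [Set.image_image]
    exact Set.image_congr fun s _ => squarefreeMonomial_eq s
  rw [this, mem_ideal_span_monomial_image]
  simp [expSet]

theorem monomial_mem_span_iff (S : Set (Finset (Fin n))) (m : Fin n →₀ ℕ) :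
    monomial m (1 : k) ∈ Ideal.span (squarefreeMonomial k '' S) ↔ m ∈ expSet S := by
  classical
  rw [mem_span_squarefreeMonomial_iff, support_monomial, if_neg one_ne_zero]
  simp

theorem mem_homogeneousComponentIdeal_iff (S : Set (Finset (Fin n))) (j : ℕ)
    (p : MvPolynomial (Fin n) k) :
    p ∈ homogeneousComponentIdeal (Ideal.span (squarefreeMonomial k '' S)) j ↔
      ∀ m ∈ p.support, m ∈ componentExpSet S j := by
  have : homogeneousComponentIdeal (Ideal.span (squarefreeMonomial k '' S)) j =
      Ideal.span ((fun m => monomial m (1 : k)) '' {m | m ∈ expSet S ∧ m.degree = j}) := by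
    refine le_antisymm (Ideal.span_le.2 ?_) (Ideal.span_mono ?_)
    · rintro f ⟨hf, hfj⟩
      refine mem_ideal_span_monomial_image.2 fun m hm => ⟨m, ⟨?_, ?_⟩, le_rfl⟩
      · exact (mem_span_squarefreeMonomial_iff S f).1 hf m hm
      · rw [Finsupp.degree_eq_weight_one]
        exact hfj (mem_support_iff.1 hm)
    · rintro _ ⟨m, ⟨hm, hmj⟩, rfl⟩
      exact ⟨(monomial_mem_span_iff S m).2 hm, isHomogeneous_monomial 1 hmj⟩
  rw [this, mem_ideal_span_monomial_image]
  simp [componentExpSet, and_assoc]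

theorem mem_squarefreeComponentIdeal_iff (S : Set (Finset (Fin n))) (j : ℕ)
    (p : MvPolynomial (Fin n) k) :
    p ∈ squarefreeComponentIdeal (Ideal.span (squarefreeMonomial k '' S)) j ↔
      ∀ m ∈ p.support, m ∈ squarefreeComponentExpSet S j := by
  have : squarefreeComponentIdeal (Ideal.span (squarefreeMonomial k '' S)) j =
      Ideal.span (squarefreeMonomial k '' {s | indExp s ∈ expSet S ∧ s.card = j}) := by
    refine congrArg Ideal.span (Set.ext fun f => ?_)
    constructor
    · rintro ⟨hf, s, hs, rfl⟩
      rw [squarefreeMonomial_eq, monomial_mem_span_iff] at hf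
      exact ⟨s, ⟨hf, hs⟩, rfl⟩
    · rintro ⟨s, ⟨hf, hs⟩, rfl⟩
      refine ⟨?_, s, hs, rfl⟩
      rwa [squarefreeMonomial_eq, monomial_mem_span_iff]
  rw [this, mem_span_squarefreeMonomial_iff]
  simp [expSet, squarefreeComponentExpSet, and_assoc]

theorem exists_eq_indExp {m : Fin n →₀ ℕ} (h : ∀ v, m v ≤ 1) : ∃ s, m = indExp s := by
  refine ⟨m.support, Finsupp.ext fun v => ?_⟩
  rw [indExp_apply]
  have := h v
  by_cases hv : m v = 0
  · simp [hv]
  · rw [if_pos (Finsupp.mem_support_iff.2 hv)]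
    omega

/-- Where `a v ≥ 2`, removing `v` once more from `x^a / x^s` preserves divisibility by squarefree
monomials. -/
theorem indExp_le_sub_insert {a : Fin n →₀ ℕ} {v : Fin n} (hv : 2 ≤ a v) {s u : Finset (Fin n)}
    (hvs : v ∉ s) (hu : indExp u ≤ a - indExp s) : indExp u ≤ a - indExp (insert v s) := by
  intro w
  have h1 := hu w
  rw [Finsupp.tsub_apply] at h1 ⊢
  rw [indExp_apply, indExp_apply] at h1 ⊢
  by_cases hw : w = v
  · subst hw
    rw [if_pos (Finset.mem_insert_self w s)]
    split_ifs <;> omega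
  · simpa [hw] using h1

/-- In a squarefree multidegree `I_{<j>}` and `I_{[j]}` have the same Koszul homology, as they
contain the same squarefree monomials. In any other multidegree `a`, a vertex `v` with `a v ≥ 2` is
the apex of a cone: of the whole complex for `I_{[j]}`, and of a complex of which that for `I_{<j>}`
is a skeleton. -/
theorem simplicialVanishes_component_iff (S : Set (Finset (Fin n))) {i j : ℕ} {t : ℤ} (ht : t ≠ j)
    {a : Fin n →₀ ℕ} (ha : (a.degree : ℤ) = t + i) :
    SimplicialVanishes k (componentExpSet S j) a i ↔
      SimplicialVanishes k (squarefreeComponentExpSet S j) a i := by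
  by_cases hsq : ∀ v, a v ≤ 1
  · refine simplicialVanishes_congr (fun m hm => ⟨?_, ?_⟩) i
    · rintro ⟨m', hm', hj, hle⟩
      obtain ⟨s, rfl⟩ := exists_eq_indExp fun v => (hle v).trans ((hm v).trans (hsq v))
      exact ⟨s, hm', by rw [← hj, degree_indExp], hle⟩
    · rintro ⟨s, hs, hj, hle⟩
      exact ⟨indExp s, hs, by rw [degree_indExp, hj], hle⟩
  · push Not at hsq
    obtain ⟨v, hv⟩ := hsq
    refine iff_of_true (simplicialVanishes_of_cone (v := v) (by omega) ?_)
      (simplicialVanishes_of_cone (v := v) (by omega) ?_)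
    · rintro s hvs hs hi ⟨m', ⟨u, hu, hum⟩, hj, hle⟩
      have h1 := indExp_le_sub_insert hv hvs (hum.trans hle)
      obtain ⟨q, hq⟩ := le_iff_exists_add.1 h1
      have hdeg := degree_sub_indExp hs
      have hdeg' := degree_sub_indExp (indExp_insert_le hvs hs (by omega : a v ≠ 0))
      rw [Finset.card_insert_of_notMem hvs, hq, map_add] at hdeg'
      have h2 := Finsupp.degree_mono hle
      have h3 := Finsupp.degree_mono hum
      -- `t ≠ j` makes room for one more vertex in the skeleton.
      obtain ⟨q', hq', hq'd⟩ := Finsupp.exists_le_degree_eq q (j - (indExp u).degree) (by omega)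
      refine ⟨indExp u + q', ⟨u, hu, le_self_add⟩, by rw [map_add, hq'd]; omega, ?_⟩
      rw [hq]
      gcongr
    · rintro s hvs hs hi ⟨u, hu, hj, hle⟩
      exact ⟨u, hu, hj, indExp_le_sub_insert hv hvs hle⟩

end Monomial

theorem proposition3p1 {k : Type*} [Field k] {n : ℕ} (r : ℕ) (hr : 1 ≤ r)
    (I : Ideal (MvPolynomial (Fin n) k)) (hI : IsSquarefreeMonomialIdeal I) :
    IsComponentwiseLinearInFirstSteps r I ↔ IsSquarefreeComponentwiseLinearInFirstSteps r I := by
  obtain ⟨S, rfl⟩ := hI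
  refine forall_congr' fun j => ?_
  rw [isLinearInFirstSteps_iff (mem_homogeneousComponentIdeal_iff S j)
      (fun m ⟨m', hm', hj, hle⟩ => ⟨m', ⟨m', hm', hj, le_rfl⟩, hle, hj⟩),
    isLinearInFirstSteps_iff (mem_squarefreeComponentIdeal_iff S j)
      (fun m ⟨s, hs, hj, hle⟩ => ⟨indExp s, ⟨s, hs, hj, le_rfl⟩, hle, by rw [degree_indExp, hj]⟩)]
  exact forall₂_congr fun i _ => forall₂_congr fun t ht => forall₂_congr fun a ha =>
    simplicialVanishes_component_iff S ht ha
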